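/- Let $(R,\mathfrak m)$ be a commutative Noetherian local ring. For every $R$-module $N$ fix a projective resolution $P_N$ of $N$, with $P_{N,i}$ its term in homological degree $i$ and $P_{N,i}=0$ for $i<0$. For $R$-modules $M,N$ let $(P_M,P_N)$ be the complex of $R$-modules whose term of cohomological degree $n\in\mathbb Z$ is $\prod_{i\in\mathbb Z}\operatorname{Hom}_R(P_{M,i},P_{N,i-n})$, with differential $f\mapsto \partial f-(-1)^{n}f\partial$. Let $(P_M,P_N)_b$ be its subcomplex of bounded maps, i.e. of those families with only finitely many non-zero components. The Vogel cohomology of the pair is $$\widetilde{\operatorname{Ext}}{}_R^{\,i}(M,N)=H^i\big((P_M,P_N)/(P_M,P_N)_b\big),\qquad i\in\mathbb Z .$$ Then for every $R$-module $M$ the following are equivalent: (i) $\operatorname{pd}_R M$ is finite (the zero module, with $\operatorname{pd}_R 0=-\infty$, counts as having finite projective dimension); (ii) $\widetilde{\operatorname{Ext}}{}_R^{\,i}(M,N)=0$ for all $i\in\mathbb Z$ and all $R$-modules $N$; (iii) $\widetilde{\operatorname{Ext}}{}_R^{\,i}(N,M)=0$ for all $i\in\mathbb Z$ and all $R$-modules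 $N$. Moreover, if $M$ is finitely generated, the same three conditions are equivalent when $N$ in (ii) and (iii) ranges over the finitely generated $R$-modules only. -/

import Mathlib

open CategoryTheory CochainComplex.HomComplex

universe u

noncomputable section

namespace Vogel

variable {R : Type u} [CommRing R]

/-- The bounded homogeneous maps of degree `n` from `F` to `G`: those families
`(F.X p ⟶ G.X (p + n))` for `p : ℤ` with only finitely many non-zero components. -/
def boundedCochain (F G : CochainComplex (ModuleCat.{u} R) ℤ) (n : ℤ) :
    Submodule R (Cochain F G n) where
  carrier := {z | {p : ℤ | z.v p (p + n) rfl ≠ 0}.Finite}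
  zero_mem' := by simp
  add_mem' {a b} ha hb := by
    refine (Set.Finite.union ha hb).subset fun p hp => ?_
    by_contra h
    simp only [Set.mem_union, Set.mem_ofPred_eq, not_or, not_not] at h
    exact hp (by rw [Cochain.add_v, h.1, h.2, add_zero])
  smul_mem' c a ha := by
    refine Set.Finite.subset ha fun p hp h => hp ?_
    rw [Cochain.smul_v, h, smul_zero]

/-- The differential of the Hom complex preserves bounded homogeneous maps. -/
lemma boundedCochain_le_comap (F G : CochainComplex (ModuleCat.{u} R) ℤ) (n m : ℤ) :
    boundedCochain F G n ≤ (boundedCochain F G m).comap (δ_hom R F G n m) := by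
  intro z hz
  change {p : ℤ | (δ n m z).v p (p + m) rfl ≠ 0}.Finite
  by_cases h : n + 1 = m
  · subst h
    have hz' : {p : ℤ | z.v p (p + n) rfl ≠ 0}.Finite := hz
    refine (hz'.union (hz'.preimage ((add_left_injective (1 : ℤ)).injOn))).subset
      fun p hp => ?_
    by_contra hc
    simp only [Set.mem_union, Set.mem_preimage, Set.mem_ofPred_eq, not_or, not_not] at hc
    apply hp
    have h2 : z.v (p + 1) (p + (n + 1)) (by ring) = 0 := by
      have key : ∀ (q : ℤ) (hq : p + 1 + n = q), z.v (p + 1) q hq = 0 := by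
        rintro _ rfl
        exact hc.2
      exact key _ _
    rw [δ_v n (n + 1) rfl z p (p + (n + 1)) rfl (p + n) (p + 1) (by ring) rfl, hc.1, h2]
    simp
  · simp [δ_shape _ _ h]

/-- The quotient of the Hom complex from `F` to `G` (in degree `n`, all families
`(F.X p ⟶ G.X (p + n))`, with differential `f ↦ d ∘ f - (-1) ^ n • f ∘ d`) by its subcomplex of
bounded homogeneous maps, as a cochain complex of `R`-modules. -/
def vogelComplex (F G : CochainComplex (ModuleCat.{u} R) ℤ) :
    CochainComplex (ModuleCat.{u} R) ℤ where
  X n := ModuleCat.of R (Cochain F G n ⧸ boundedCochain F G n)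
  d n m := ModuleCat.ofHom
    ((boundedCochain F G n).mapQ (boundedCochain F G m) (δ_hom R F G n m)
      (boundedCochain_le_comap F G n m))
  shape n m h := by
    ext x
    have : n + 1 ≠ m := h
    simp [δ_shape _ _ this]
  d_comp_d' i j k _ _ := by
    ext x
    simp [δ_δ]

/-- Vogel cohomology in degree `i` of the pair of modules `(M, N)`, computed with the projective
resolutions `P` of `M` and `Q` of `N`; these are regarded as cochain complexes, with the
`j`-th term of a resolution placed in degree `-j`. -/
def vogelExt {M N : ModuleCat.{u} R} (P : ProjectiveResolution M) (Q : ProjectiveResolution N)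
    (i : ℤ) : ModuleCat.{u} R :=
  (vogelComplex P.cochainComplex Q.cochainComplex).homology i

end Vogel

end

/-!
Both vanishing conditions, applied to `N = M` in degree `0`, say that the identity of `P M` is a
boundary modulo bounded maps: there is a map `s` of degree `-1` with `d s + s d = 1` in all but
finitely many degrees. Composing cocycles with such an `s` kills the Vogel cohomology in either
variable. On the other hand, such an `s` makes all high syzygies of `M` retracts of projectives, and
projective high syzygies split the resolution far out, which yields an `s`; and `pd M` is finite
exactly when the high syzygies are projective.
-/

namespace Vogel

open Limits Filter

section Opcycles

variable {C : Type*} [Category* C] [Abelian C]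

section

variable {ι : Type*} {c : ComplexShape ι} (K : HomologicalComplex C c)

/-- The sequence `K.opcycles i ⟶ K.X j ⟶ K.opcycles j`. For a projective resolution the opcycles
are the syzygies, and this is the sequence relating two consecutive ones. -/
noncomputable abbrev opcyclesShortComplex (i j : ι) : ShortComplex C :=
  .mk (K.fromOpcycles i j) (K.pOpcycles j) (by simp [← cancel_epi (K.pOpcycles i)])

variable {K}

lemma opcyclesShortComplex_shortExact {i j : ι} (hij : c.Rel i j) (hi : K.ExactAt i) :
    (opcyclesShortComplex K i j).ShortExact where
  exact := by
    let φ : ShortComplex.mk _ _ (K.d_pOpcycles i j) ⟶ opcyclesShortComplex K i j :=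
      { τ₁ := K.pOpcycles i
        τ₂ := 𝟙 _
        τ₃ := 𝟙 _ }
    have : Epi φ.τ₁ := inferInstanceAs (Epi (K.pOpcycles i))
    have : IsIso φ.τ₂ := inferInstanceAs (IsIso (𝟙 (K.X j)))
    have : Mono φ.τ₃ := inferInstanceAs (Mono (𝟙 (K.opcycles j)))
    rw [← ShortComplex.exact_iff_of_epi_of_isIso_of_mono φ]
    exact ShortComplex.exact_of_g_is_cokernel _ (K.opcyclesIsCokernel i j (c.prev_eq' hij))
  mono_f := Preadditive.mono_of_isZero_kernel' _ (K.homologyIsKernel i j (c.next_eq' hij))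
    hi.isZero_homology
  epi_g := inferInstance

lemma contraction_of_splittings {i j k l : ι} (σ : (opcyclesShortComplex K i j).Splitting)
    (σ' : (opcyclesShortComplex K j k).Splitting) (σ'' : (opcyclesShortComplex K k l).Splitting) :
    K.d k l ≫ σ''.r ≫ σ'.s + (σ'.r ≫ σ.s) ≫ K.d j k = 𝟙 (K.X k) := by
  have hσ : σ.s ≫ K.pOpcycles j = 𝟙 _ := σ.s_g
  have hσ' : σ'.r ≫ K.fromOpcycles j k + K.pOpcycles k ≫ σ'.s = 𝟙 _ := σ'.id
  have hσ'' : K.fromOpcycles k l ≫ σ''.r = 𝟙 _ := σ''.f_r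
  rw [← K.p_fromOpcycles, ← K.p_fromOpcycles, Category.assoc, Category.assoc,
    reassoc_of% hσ, reassoc_of% hσ'', add_comm, hσ']

lemma projective_opcycles_of_contraction {i j k : ι} [Projective (K.X k)]
    {s : K.X j ⟶ K.X i} {t : K.X k ⟶ K.X j} (h : K.d j k ≫ t + s ≫ K.d i j = 𝟙 _) :
    Projective (K.opcycles j) := by
  have retract : K.fromOpcycles j k ≫ t ≫ K.pOpcycles j = 𝟙 _ := by
    rw [← cancel_epi (K.pOpcycles j)]
    simpa using h =≫ K.pOpcycles j
  exact Retract.projective ⟨_, t ≫ K.pOpcycles j, retract⟩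

end

variable {M : C} (P : ProjectiveResolution M)

/-- The zeroth syzygy of `M`, as computed by a projective resolution, is `M` itself. -/
noncomputable def opcyclesZeroIso : P.cochainComplex.opcycles 0 ≅ M :=
  (P.cochainComplex.isoHomologyι 0 1 (by simp)
    ((CochainComplex.isZero_of_isStrictlyLE P.cochainComplex 0 1).eq_of_tgt _ _)).symm ≪≫
    isoOfQuasiIsoAt P.π' 0 ≪≫ HomologicalComplex.singleObjHomologySelfIso _ _ _

lemma hasProjectiveDimensionLT_opcycles_iff (m k : ℕ) :
    HasProjectiveDimensionLT (P.cochainComplex.opcycles (-m)) (k + 1) ↔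
      HasProjectiveDimensionLT M (m + k + 1) := by
  induction m generalizing k with
  | zero =>
    rw [zero_add]
    exact ⟨fun (_ : HasProjectiveDimensionLT (P.cochainComplex.opcycles 0) (k + 1)) =>
        hasProjectiveDimensionLT_of_iso (opcyclesZeroIso P) _,
      fun _ => hasProjectiveDimensionLT_of_iso (opcyclesZeroIso P).symm _⟩
  | succ m ih =>
    have hexact : P.cochainComplex.ExactAt (-(m + 1 : ℕ)) :=
      P.cochainComplex.exactAt_of_isGE 0 _ (by lia)
    have hsyzygy := opcyclesShortComplex_shortExact (j := -(m : ℤ)) (by simp) hexact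
    rw [show m + 1 + k + 1 = m + (k + 1) + 1 by lia, ← ih]
    exact (hsyzygy.hasProjectiveDimensionLT_X₃_iff k inferInstance).symm

lemma projectiveDimension_ne_top_iff_eventually_projective_opcycles :
    projectiveDimension M ≠ ⊤ ↔ ∀ᶠ p in atBot, Projective (P.cochainComplex.opcycles p) := by
  have projective_iff (n : ℕ) :
      Projective (P.cochainComplex.opcycles (-n)) ↔ HasProjectiveDimensionLT M (n + 1) :=
    projective_iff_hasProjectiveDimensionLT_one.trans
      (hasProjectiveDimensionLT_opcycles_iff P n 0)
  rw [projectiveDimension_ne_top_iff, eventually_atBot]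
  constructor
  · rintro ⟨n, hn⟩
    refine ⟨-n, fun p hp => ?_⟩
    obtain ⟨m, rfl⟩ := Int.exists_eq_neg_ofNat (show p ≤ 0 by lia)
    exact (projective_iff m).2 (hasProjectiveDimensionLT_of_ge M (n + 1) _ (by lia))
  · rintro ⟨p, hp⟩
    exact ⟨p.natAbs, (projective_iff p.natAbs).1 (hp _ (by lia))⟩

end Opcycles

variable {R : Type u} [CommRing R] {F G H : CochainComplex (ModuleCat.{u} R) ℤ}

-- The target degree is a function `e`, since `p + n` is often not the syntactic form at hand.
lemma mem_boundedCochain_iff {n : ℤ} {e : ℤ → ℤ} (he : ∀ p, p + n = e p) (z : Cochain F G n) :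
    z ∈ boundedCochain F G n ↔ ∀ᶠ p in cofinite, z.v p (e p) (he p) = 0 := by
  obtain rfl : (fun p => p + n) = e := funext he
  rfl

lemma comp_mem_boundedCochain_of_left {a b c : ℤ} {z : Cochain F G a}
    (hz : z ∈ boundedCochain F G a) (w : Cochain G H b) (h : a + b = c) :
    z.comp w h ∈ boundedCochain F H c := by
  rw [mem_boundedCochain_iff (fun _ => rfl)] at hz ⊢
  filter_upwards [hz] with p hp
  rw [Cochain.comp_v z w h p (p + a) (p + c) rfl (by lia), hp, zero_comp]

lemma comp_mem_boundedCochain_of_right {a b c : ℤ} (z : Cochain F G a) {w : Cochain G H b}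
    (hw : w ∈ boundedCochain G H b) (h : a + b = c) :
    z.comp w h ∈ boundedCochain F H c := by
  rw [mem_boundedCochain_iff (fun _ => rfl)] at hw
  rw [mem_boundedCochain_iff (e := fun p => p + a + b) (by lia)]
  filter_upwards [(add_left_injective a).tendsto_cofinite.eventually hw] with p hp
  rw [Cochain.comp_v z w h p (p + a) (p + a + b) rfl rfl, hp, comp_zero]

lemma isZero_homology_vogelComplex_iff (i : ℤ) :
    IsZero ((vogelComplex F G).homology i) ↔
      ∀ z : Cochain F G i, δ i (i + 1) z ∈ boundedCochain F G (i + 1) →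
        ∃ w : Cochain F G (i - 1), z - δ (i - 1) i w ∈ boundedCochain F G i := by
  rw [← HomologicalComplex.exactAt_iff_isZero_homology,
    HomologicalComplex.exactAt_iff' _ (i - 1) i (i + 1) (by simp) (by simp),
    ShortComplex.moduleCat_exact_iff]
  constructor
  · intro h z hz
    obtain ⟨w, hw⟩ := h (Submodule.Quotient.mk z) ((Submodule.Quotient.mk_eq_zero _).2 hz)
    obtain ⟨w, rfl⟩ := Submodule.Quotient.mk_surjective _ w
    exact ⟨w, (Submodule.Quotient.eq _).1 hw.symm⟩
  · intro h z hz
    obtain ⟨z, rfl⟩ := Submodule.Quotient.mk_surjective _ z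
    obtain ⟨w, hw⟩ := h z ((Submodule.Quotient.mk_eq_zero _).1 hz)
    exact ⟨Submodule.Quotient.mk w, ((Submodule.Quotient.eq _).2 hw).symm⟩

/-- The identity of `F` is homotopic to zero up to a bounded map; this is what the vanishing of the
class of `𝟙 F` in the Vogel cohomology of the pair `(F, F)` means. -/
def IsContractibleModBounded (F : CochainComplex (ModuleCat.{u} R) ℤ) : Prop :=
  ∃ s : Cochain F F (-1), Cochain.ofHom (𝟙 F) - δ (-1) 0 s ∈ boundedCochain F F 0

lemma isContractibleModBounded_of_isZero_homology
    (hF : IsZero ((vogelComplex F F).homology 0)) : IsContractibleModBounded F :=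
  (isZero_homology_vogelComplex_iff 0).1 hF (Cochain.ofHom (𝟙 F)) (by simp)

lemma isContractibleModBounded_iff_eventually :
    IsContractibleModBounded F ↔ ∃ s : Cochain F F (-1), ∀ᶠ p in cofinite,
      F.d p (p + 1) ≫ s.v (p + 1) p (by lia) + s.v p (p - 1) rfl ≫ F.d (p - 1) p = 𝟙 _ := by
  refine exists_congr fun s => (mem_boundedCochain_iff add_zero _).trans ?_
  refine eventually_congr (.of_forall fun p => ?_)
  rw [Cochain.sub_v, Cochain.ofHom_v, HomologicalComplex.id_f,
    δ_v (-1) 0 rfl s p p (add_zero p) (p - 1) (p + 1) rfl rfl, Int.negOnePow_zero, one_smul,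
    sub_eq_zero, add_comm, eq_comm]

namespace IsContractibleModBounded

lemma isZero_homology_of_source (hF : IsContractibleModBounded F) (i : ℤ) :
    IsZero ((vogelComplex F G).homology i) := by
  obtain ⟨s, hs⟩ := hF
  refine (isZero_homology_vogelComplex_iff i).2 fun z hz =>
    ⟨i.negOnePow • s.comp z (by lia), ?_⟩
  have leibniz := δ_comp s z (show -1 + i = i - 1 by lia) 0 (i + 1) i (by lia) (by lia) rfl
  have decomposition : z - δ (i - 1) i (i.negOnePow • s.comp z (by lia)) =
      (Cochain.ofHom (𝟙 F) - δ (-1) 0 s).comp z (zero_add i) -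
        i.negOnePow • s.comp (δ i (i + 1) z) (by lia) := by
    rw [δ_units_smul, leibniz, smul_add, smul_smul, Int.units_mul_self, one_smul,
      Cochain.sub_comp, Cochain.id_comp]
    abel
  rw [decomposition]
  exact Submodule.sub_mem _ (comp_mem_boundedCochain_of_left hs z _)
    (Submodule.smul_of_tower_mem _ _ (comp_mem_boundedCochain_of_right s hz _))

lemma isZero_homology_of_target (hG : IsContractibleModBounded G) (i : ℤ) :
    IsZero ((vogelComplex F G).homology i) := by
  obtain ⟨s, hs⟩ := hG
  refine (isZero_homology_vogelComplex_iff i).2 fun z hz => ⟨z.comp s (by lia), ?_⟩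
  have leibniz := δ_comp z s (show i + -1 = i - 1 by lia) (i + 1) 0 i (by lia) rfl (by lia)
  have decomposition : z - δ (i - 1) i (z.comp s (by lia)) =
      z.comp (Cochain.ofHom (𝟙 G) - δ (-1) 0 s) (add_zero i) +
        (δ i (i + 1) z).comp s (by lia) := by
    rw [leibniz, Cochain.comp_sub, Cochain.comp_id, Int.negOnePow_neg, Int.negOnePow_one,
      Units.neg_smul, one_smul]
    abel
  rw [decomposition]
  exact Submodule.add_mem _ (comp_mem_boundedCochain_of_right z hs _)
    (comp_mem_boundedCochain_of_left hz s _)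

lemma eventually_projective_opcycles (hF : IsContractibleModBounded F)
    (hproj : ∀ᶠ p in atBot, Projective (F.X p)) :
    ∀ᶠ p in atBot, Projective (F.opcycles p) := by
  obtain ⟨s, hs⟩ := isContractibleModBounded_iff_eventually.1 hF
  rw [Int.cofinite_eq, eventually_sup] at hs
  filter_upwards [hs.1, (tendsto_atBot_add_const_right atBot 1 tendsto_id).eventually hproj]
    with p hp (_ : Projective (F.X (p + 1)))
  exact projective_opcycles_of_contraction hp

end IsContractibleModBounded

lemma isContractibleModBounded_of_eventually_projective_opcycles
    (hzero : ∀ᶠ p in atTop, IsZero (F.X p)) (hexact : ∀ᶠ p in atBot, F.ExactAt p)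
    (hproj : ∀ᶠ p in atBot, Projective (F.opcycles p)) : IsContractibleModBounded F := by
  obtain ⟨b, hb⟩ := eventually_atBot.1 (hexact.and hproj)
  have σ (p q : ℤ) (hpq : p + 1 = q) (hq : q ≤ b) : (opcyclesShortComplex F p q).Splitting :=
    have : Projective (F.opcycles q) := (hb q hq).2
    (opcyclesShortComplex_shortExact hpq (hb p (by lia)).1).splittingOfProjective
  let s : Cochain F F (-1) := Cochain.mk fun p q hpq =>
    if hp : p ≤ b then (σ q p (by lia) hp).r ≫ (σ (q - 1) q (by lia) (by lia)).s else 0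
  refine isContractibleModBounded_iff_eventually.2 ⟨s, ?_⟩
  rw [Int.cofinite_eq, eventually_sup]
  constructor
  · filter_upwards [eventually_le_atBot (b - 1)] with p hp
    rw [Cochain.mk_v, Cochain.mk_v, dif_pos (by lia), dif_pos (by lia)]
    exact contraction_of_splittings _ _ _
  · filter_upwards [hzero] with p hp
    exact hp.eq_of_src _ _

lemma isContractibleModBounded_cochainComplex_iff {M : ModuleCat.{u} R}
    (P : ProjectiveResolution M) :
    IsContractibleModBounded P.cochainComplex ↔ projectiveDimension M ≠ ⊤ := by
  rw [projectiveDimension_ne_top_iff_eventually_projective_opcycles P]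
  refine ⟨fun h => h.eventually_projective_opcycles (.of_forall fun _ => inferInstance),
    isContractibleModBounded_of_eventually_projective_opcycles ?_ ?_⟩
  · filter_upwards [eventually_gt_atTop 0] with p hp
    exact P.cochainComplex.isZero_of_isStrictlyLE 0 p hp
  · filter_upwards [eventually_lt_atBot 0] with p hp
    exact P.cochainComplex.exactAt_of_isGE 0 p hp

end Vogel

theorem proposition1p1_general {R : Type u} [CommRing R]
    (P : ∀ N : ModuleCat.{u} R, ProjectiveResolution N) (S : ObjectProperty (ModuleCat.{u} R))
    {M : ModuleCat.{u} R} (hM : S M) :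
    List.TFAE
      [projectiveDimension M ≠ ⊤,
       ∀ (i : ℤ) (N : ModuleCat.{u} R), S N → Limits.IsZero (Vogel.vogelExt (P M) (P N) i),
       ∀ (i : ℤ) (N : ModuleCat.{u} R), S N → Limits.IsZero (Vogel.vogelExt (P N) (P M) i)] := by
  rw [← Vogel.isContractibleModBounded_cochainComplex_iff (P M)]
  tfae_have 1 → 2 := fun h i N _ => h.isZero_homology_of_source i
  tfae_have 1 → 3 := fun h i N _ => h.isZero_homology_of_target i
  tfae_have 2 → 1 := fun h => Vogel.isContractibleModBounded_of_isZero_homology (h 0 M hM)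
  tfae_have 3 → 1 := fun h => Vogel.isContractibleModBounded_of_isZero_homology (h 0 M hM)
  tfae_finish

theorem proposition1p1 {R : Type u} [CommRing R] [IsNoetherianRing R] [IsLocalRing R]
    (P : ∀ N : ModuleCat.{u} R, ProjectiveResolution N) (M : ModuleCat.{u} R) :
    List.TFAE
      [projectiveDimension M ≠ ⊤,
       ∀ (i : ℤ) (N : ModuleCat.{u} R), Limits.IsZero (Vogel.vogelExt (P M) (P N) i),
       ∀ (i : ℤ) (N : ModuleCat.{u} R), Limits.IsZero (Vogel.vogelExt (P N) (P M) i)] ∧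
    (Module.Finite R M → List.TFAE
      [projectiveDimension M ≠ ⊤,
       ∀ (i : ℤ) (N : ModuleCat.{u} R), Module.Finite R N →
         Limits.IsZero (Vogel.vogelExt (P M) (P N) i),
       ∀ (i : ℤ) (N : ModuleCat.{u} R), Module.Finite R N →
         Limits.IsZero (Vogel.vogelExt (P N) (P M) i)]) :=
  ⟨by simpa using proposition1p1_general P ⊤ (M := M) trivial,
    proposition1p1_general P (fun N => Module.Finite R N)⟩
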